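/- **Theorem.** Let $n\in\mathbb N$. For $k,l\in\mathbb Z^n$ and $\varphi\in L^2(\mathbb R^{2n})$ define the twisted translate $$T^t_{(k,l)}\varphi(x,y)=e^{\pi i(x\cdot l-y\cdot k)}\,\varphi(x-k,\,y-l),\qquad (x,y)\in\mathbb R^n\times\mathbb R^n,$$ and let $V^t(\varphi)=\overline{\operatorname{span}}\{T^t_{(k,l)}\varphi : k,l\in\mathbb Z^n\}$ be the principal twisted shift-invariant space generated by $\varphi$. Let $V\subset L^2(\mathbb R^{2n})$ be a twisted shift-invariant subspace, that is, a closed linear subspace with $T^t_{(k,l)}f\in V$ for all $f\in V$ and $k,l\in\mathbb Z^n$. Then there exists a sequence $(\varphi_i)_{i\in\mathbb N}$ in $L^2(\mathbb R^{2n})$ (some $\varphi_i$ may be $0$) such that $$V=\bigoplus_{i\in\mathbb N}V^t(\varphi_i)$$ as an orthogonal Hilbert space direct sum (the spaces $V^t(\varphi_i)$ are mutually orthogonal and the closure of their algebraic sum is $V$), and each $\varphi_i$ is a Parseval frame generator of $V^t(\varphi_i)$, i.e. $$\sum_{k,l\in\mathbb Z^n}\bigl|\langle f,T^t_{(k,l)}\varphi_i\rangle\bigr|^2=\|f\|^2\qquad\text{for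 all } f\in V^t(\varphi_i).$$ -/

import Mathlib

open MeasureTheory
open scoped ENNReal Matrix

/-- `ℝ²ⁿ = ℝⁿ × ℝⁿ` with Lebesgue measure (only the measure and the dot product are used). -/
abbrev PhaseSpace (n : ℕ) : Type := (Fin n → ℝ) × (Fin n → ℝ)

/-- The complex Hilbert space `L²(ℝ²ⁿ)`. -/
abbrev L2Phase (n : ℕ) : Type := Lp ℂ 2 (volume : Measure (PhaseSpace n))

/-- The inclusion `ℤⁿ ⊂ ℝⁿ`. -/
def intVec {n : ℕ} (k : Fin n → ℤ) : Fin n → ℝ := fun j => (k j : ℝ)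

/-- The twisted translate of a function:
`(x, y) ↦ exp(π i (x ⋅ l - y ⋅ k)) f(x - k, y - l)`. -/
noncomputable def twistedTranslateFun {n : ℕ} (k l : Fin n → ℤ) (f : PhaseSpace n → ℂ) :
    PhaseSpace n → ℂ := fun z =>
  Complex.exp (((Real.pi * (z.1 ⬝ᵥ intVec l - z.2 ⬝ᵥ intVec k) : ℝ) : ℂ) * Complex.I) *
    f (z.1 - intVec k, z.2 - intVec l)

theorem memLp_twistedTranslateFun {n : ℕ} (k l : Fin n → ℤ) {f : PhaseSpace n → ℂ}
    (hf : MemLp f 2 volume) : MemLp (twistedTranslateFun k l f) 2 volume := by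
  have h : MeasurePreserving
      (Prod.map (fun x => x - intVec k) (fun y => y - intVec l) : PhaseSpace n → PhaseSpace n)
      volume volume :=
    (measurePreserving_sub_right volume (intVec k)).prod
      (measurePreserving_sub_right volume (intVec l))
  have h1 : MemLp (fun z : PhaseSpace n => f (z.1 - intVec k, z.2 - intVec l)) 2 volume :=
    hf.comp_measurePreserving h
  have hc : Continuous (fun z : PhaseSpace n => Complex.exp
      (((Real.pi * (z.1 ⬝ᵥ intVec l - z.2 ⬝ᵥ intVec k) : ℝ) : ℂ) * Complex.I)) := by
    simp only [dotProduct]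
    fun_prop
  refine h1.of_le (hc.aestronglyMeasurable.mul h1.1) (Filter.Eventually.of_forall fun z => ?_)
  simp only [twistedTranslateFun]
  rw [norm_mul, Complex.norm_exp_ofReal_mul_I, one_mul]

/-- The twisted translation `T^t_{(k,l)}` on `L²(ℝ²ⁿ)`. -/
noncomputable def twistedTranslation {n : ℕ} (k l : Fin n → ℤ) (f : L2Phase n) : L2Phase n :=
  (memLp_twistedTranslateFun k l (Lp.memLp f)).toLp (twistedTranslateFun k l f)

/-- A twisted shift-invariant space: a closed subspace of `L²(ℝ²ⁿ)` that is mapped into itself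
by all twisted translations. -/
structure IsTwistedShiftInvariant {n : ℕ} (V : Submodule ℂ (L2Phase n)) : Prop where
  isClosed : IsClosed (V : Set (L2Phase n))
  translate_mem : ∀ f ∈ V, ∀ k l : Fin n → ℤ, twistedTranslation k l f ∈ V

/-- The principal twisted shift-invariant space `V^t(φ)`: the closed linear span of all
twisted translates of `φ`. -/
noncomputable def principalSpace {n : ℕ} (φ : L2Phase n) : Submodule ℂ (L2Phase n) :=
  (Submodule.span ℂ (Set.range fun p : (Fin n → ℤ) × (Fin n → ℤ) =>
    twistedTranslation p.1 p.2 φ)).topologicalClosure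

/-- `ψ` is a Parseval frame generator of `W`:
`∑_{k,l} |⟨f, T^t_{(k,l)} ψ⟩|² = ‖f‖²` for all `f ∈ W`. -/
def IsParsevalFrameGenerator {n : ℕ} (ψ : L2Phase n) (W : Submodule ℂ (L2Phase n)) : Prop :=
  ∀ f ∈ W, HasSum (fun p : (Fin n → ℤ) × (Fin n → ℤ) =>
    ‖inner ℂ (twistedTranslation p.1 p.2 ψ) f‖ ^ 2) (‖f‖ ^ 2)

/-- `V` is the orthogonal (Hilbert space) direct sum of its subspaces `W i`. -/
structure IsOrthogonalDirectSum {n : ℕ} {ι : Type} (V : Submodule ℂ (L2Phase n))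
    (W : ι → Submodule ℂ (L2Phase n)) : Prop where
  orthogonal : ∀ i j, i ≠ j → W i ⟂ W j
  closure_iSup : (⨆ i, W i).topologicalClosure = V

/-!
The operators `T p = T^t_{(k,l)}`, `p = (k, l)`, form a projective unitary representation of `ℤ²ⁿ`
(`twistedTranslation_twistedTranslation`), with adjoint `T (-p)` of `T p`
(`adjoint_twistedTranslationL`). A function `e` of norm one that vanishes outside the unit cube
`[0, 1)²ⁿ` has an orthonormal orbit, because the translates of the cube by `ℤ²ⁿ` are disjoint; and
since these translates cover `ℝ²ⁿ`, countably many such functions `e i` have orbits that together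
span `L²(ℝ²ⁿ)` (`exists_total_parseval_sequence`). Let `E i` be the closed span of the orbit
of `e i`.

For a closed invariant subspace `V`, let `A` be the orthogonal projection onto `V` followed by that
onto `E 0`, and `A = S |A|` its polar decomposition. Everything here commutes with the `T p`, so
the partial isometry `S` maps `(ker A)ᗮ ⊆ V` isometrically and equivariantly into `E 0`. Hence
`φ = S† (e 0)` satisfies `⟨T p φ, f⟩ = ⟨T p (e 0), S f⟩`, and Parseval's identity in `E 0` turns
into the Parseval property of `φ` on `(ker A)ᗮ`, which is therefore the space generated by `φ`.
What is left of `V` is its intersection with the orthogonal complement of `E 0`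
(`exists_parseval_generator`). Repeating this with `E 1`, `E 2`, … exhausts `V`, because only `0` is
orthogonal to all `E i` (`exists_orthogonal_parseval_generators`).
-/

section OrbitSpan

open Submodule ContinuousLinearMap

variable {H ι : Type*} [NormedAddCommGroup H] [InnerProductSpace ℂ H]

/-! ### Orbit spans -/

/-- The closed linear span of the orbit of `φ` under a family of operators. -/
def orbitSpan (T : ι → H →L[ℂ] H) (φ : H) : Submodule ℂ H :=
  (span ℂ (Set.range fun p => T p φ)).topologicalClosure

theorem orbitSpan_le {T : ι → H →L[ℂ] H} {φ : H} {V : Submodule ℂ H}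
    (hV : IsClosed (V : Set H)) (h : ∀ p, T p φ ∈ V) : orbitSpan T φ ≤ V :=
  topologicalClosure_minimal _ (span_le.2 (Set.range_subset_iff.2 h)) hV

theorem apply_mem_orbitSpan (T : ι → H →L[ℂ] H) (φ : H) (p : ι) : T p φ ∈ orbitSpan T φ :=
  le_topologicalClosure _ (subset_span ⟨p, rfl⟩)

variable [CompleteSpace H]

/-- Parseval's identity, for a vector whose orbit is orthonormal. -/
theorem hasSum_of_orthonormal_orbit {T : ι → H →L[ℂ] H} {e : H}
    (he : Orthonormal ℂ fun p => T p e) {f : H} (hf : f ∈ orbitSpan T e) :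
    HasSum (fun p => ‖inner ℂ (T p e) f‖ ^ 2) (‖f‖ ^ 2) := by
  have : CompleteSpace (orbitSpan T e) := (isClosed_topologicalClosure _).completeSpace_coe
  have ho := he.codRestrict (orbitSpan T e) (apply_mem_orbitSpan T e)
  let b := HilbertBasis.mkOfOrthogonalEqBot ho <| by
    rw [Submodule.eq_bot_iff]
    intro y hy
    have h1 : (y : H) ∈ (orbitSpan T e)ᗮ := by
      unfold orbitSpan
      rw [Submodule.orthogonal_closure, mem_orthogonal]
      intro u hu
      induction hu using span_induction with
      | mem x hx =>
        obtain ⟨p, rfl⟩ := hx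
        exact hy _ (subset_span ⟨p, rfl⟩)
      | zero => simp
      | add x z _ _ hx hz => rw [inner_add_left, hx, hz, add_zero]
      | smul c x _ hx => rw [inner_smul_left, hx, mul_zero]
    exact Subtype.ext (inner_self_eq_zero.1 (h1 _ y.2))
  have hb : ∀ p, inner ℂ (T p e) f = b.repr ⟨f, hf⟩ p := fun p => by
    rw [b.repr_apply_apply, HilbertBasis.coe_mkOfOrthogonalEqBot]
    rfl
  have h := lp.hasSum_norm (p := 2) (by norm_num) (b.repr ⟨f, hf⟩)
  rw [b.repr.norm_map] at h
  simpa [hb] using h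

/-! ### Polar decomposition -/

theorem CFC.norm_abs_apply (A : H →L[ℂ] H) (x : H) : ‖CFC.abs A x‖ = ‖A x‖ := by
  have hsa : adjoint (CFC.abs A) = CFC.abs A := (CFC.abs_nonneg A).isSelfAdjoint
  have h : adjoint (CFC.abs A) * CFC.abs A = adjoint A * A := by
    rw [hsa, CFC.abs_mul_abs]; rfl
  have h2 : ‖CFC.abs A x‖ ^ 2 = ‖A x‖ ^ 2 := by
    rw [apply_norm_sq_eq_inner_adjoint_left, apply_norm_sq_eq_inner_adjoint_left]
    exact congrArg (fun B : H →L[ℂ] H => RCLike.re (inner ℂ (B x) x)) h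
  exact (sq_eq_sq₀ (norm_nonneg _) (norm_nonneg _)).1 h2

/-- Polar decomposition `A = S |A|`, for the partial isometry `S` with initial space `(ker A)ᗮ`. The
last clause is what makes it useful for representations: whatever commutes with `A` and `A†`
commutes with `S`. -/
theorem exists_polarDecomposition (A : H →L[ℂ] H) :
    ∃ S : H →L[ℂ] H, (∀ x, S (CFC.abs A x) = A x) ∧ (∀ x, A x = 0 → S x = 0) ∧
      (∀ x ∈ A.kerᗮ, ‖S x‖ = ‖x‖) ∧ (∀ x, S x ∈ A.range.topologicalClosure) ∧
      ∀ T : H →L[ℂ] H, Commute T A → Commute T (adjoint A) → Commute T S := by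
  set B := CFC.abs A with hB
  have hBn : ∀ x, ‖B x‖ = ‖A x‖ := CFC.norm_abs_apply A
  have hsa : ∀ x y, inner ℂ (B x) y = inner ℂ x (B y) := fun x y => by
    have : adjoint B = B := (CFC.abs_nonneg A).isSelfAdjoint
    rw [← adjoint_inner_right, this]
  have hker : ∀ x, B x = 0 ↔ A x = 0 := fun x => by
    rw [← norm_eq_zero, hBn, norm_eq_zero]
  have hBK : ∀ x, B x ∈ A.kerᗮ := fun x y hy => by
    rw [← hsa, (hker y).2 hy, inner_zero_left]
  -- `|A|`, viewed as a map into the initial space `(ker A)ᗮ`, has dense range.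
  let e : H →ₗ[ℂ] A.kerᗮ := B.toLinearMap.codRestrict _ hBK
  have hd : DenseRange e := by
    have : Dense ((LinearMap.range e : Submodule ℂ A.kerᗮ) : Set A.kerᗮ) := by
      rw [Submodule.dense_iff_topologicalClosure_eq_top, Submodule.topologicalClosure_eq_top_iff,
        Submodule.eq_bot_iff]
      intro y hy
      have h1 : B (y : H) = 0 := by
        refine ext_inner_left ℂ fun x => ?_
        have := hy (e x) (LinearMap.mem_range_self e x)
        rw [inner_zero_right, ← hsa]
        exact this
      have h2 : inner ℂ (y : H) (y : H) = 0 := y.2 _ ((hker _).1 h1)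
      exact Subtype.ext (inner_self_eq_zero.1 h2)
    exact this
  have hbd : ∀ x, ‖A.toLinearMap x‖ ≤ 1 * ‖e x‖ := fun x => by
    rw [one_mul]; exact (hBn x).ge
  let S₀ : A.kerᗮ →L[ℂ] H := A.toLinearMap.extendOfNorm e
  have hS₀ : ∀ x, S₀ (e x) = A x := LinearMap.extendOfNorm_eq hd ⟨1, hbd⟩
  let S : H →L[ℂ] H := S₀ ∘L A.kerᗮ.orthogonalProjectionOnto
  have hSB : ∀ x, S (B x) = A x := fun x => by
    rw [← hS₀]
    exact congrArg S₀ (orthogonalProjectionOnto_mem_subspace_eq_self (e x))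
  have hS0 : ∀ x, A x = 0 → S x = 0 := fun x hx => by
    have : A.kerᗮ.orthogonalProjectionOnto x = 0 :=
      orthogonalProjectionOnto_eq_zero_iff.2
        (Submodule.le_orthogonal_orthogonal _ hx)
    simp [S, this]
  have hSK : ∀ y : A.kerᗮ, S y = S₀ y := fun y =>
    congrArg S₀ (orthogonalProjectionOnto_mem_subspace_eq_self y)
  refine ⟨S, hSB, hS0, fun x hx => ?_, fun x => ?_, fun T h1 h2 => ?_⟩
  · have : ∀ y : A.kerᗮ, ‖S y‖ = ‖y‖ := by
      intro y
      refine hd.induction_on y (isClosed_eq (by fun_prop) (by fun_prop)) fun z => ?_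
      rw [hSK, hS₀]
      exact (hBn z).symm
    exact this ⟨x, hx⟩
  · change S₀ _ ∈ _
    generalize A.kerᗮ.orthogonalProjectionOnto x = y
    refine hd.induction_on y
      ((isClosed_topologicalClosure A.range).preimage S₀.continuous) fun z => ?_
    rw [hS₀]
    exact le_topologicalClosure _ (LinearMap.mem_range_self _ z)
  -- `|A|` is the square root of `A† A`, which commutes with `T`; hence so does `|A|`.
  · have hTc : Commute T B :=
      (Commute.cfcₙ_nnreal (h2.mul_right h1).symm NNReal.sqrt).symm
    have hTB : ∀ x, T (B x) = B (T x) := fun x =>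
      congrArg (fun C : H →L[ℂ] H => C x) hTc
    have hTA : ∀ x, T (A x) = A (T x) := fun x => congrArg (fun C : H →L[ℂ] H => C x) h1
    have key : ∀ y : A.kerᗮ, T (S y) = S (T y) := by
      intro y
      refine hd.induction_on y (isClosed_eq (by fun_prop) (by fun_prop)) fun z => ?_
      change T (S (B z)) = S (T (B z))
      rw [hTB, hSB, hSB, hTA]
    ext x
    change T (S x) = S (T x)
    obtain ⟨u, hu, v, hv, rfl⟩ := A.ker.exists_add_mem_mem_orthogonal x
    have hu' : A u = 0 := hu
    rw [map_add, map_add, map_add, map_add, key ⟨v, hv⟩, hS0 u hu',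
      hS0 (T u) (by rw [← hTA, hu', map_zero]), map_zero]

/-! ### Parseval generators of invariant subspaces -/

/-- An operator commutes with the orthogonal projection onto any subspace that reduces it. -/
theorem commute_starProjection {T : H →L[ℂ] H} {V : Submodule ℂ H} [V.HasOrthogonalProjection]
    (h : ∀ f ∈ V, T f ∈ V) (h' : ∀ f ∈ V, adjoint T f ∈ V) : Commute T V.starProjection := by
  ext x
  change T (V.starProjection x) = V.starProjection (T x)
  refine (eq_starProjection_of_mem_orthogonal (h _ (starProjection_apply_mem _ _)) ?_).symm
  rw [← map_sub]
  intro y hy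
  rw [← adjoint_inner_left]
  exact sub_starProjection_mem_orthogonal x _ (h' y hy)

/-- For a family of operators closed under adjoints, the orthogonal complement of an invariant
subspace is invariant. -/
theorem mem_orthogonal_of_adjoint {T : ι → H →L[ℂ] H} (hT : ∀ p, ∃ q, adjoint (T p) = T q)
    {V : Submodule ℂ H} (hV : ∀ p, ∀ f ∈ V, T p f ∈ V) (p : ι) {f : H} (hf : f ∈ Vᗮ) :
    T p f ∈ Vᗮ := by
  obtain ⟨q, hq⟩ := hT p
  intro y hy
  rw [← adjoint_inner_left, hq]
  exact hf _ (hV q y hy)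

/-- If the orbit of `e` satisfies Parseval's identity on `E`, then the orthogonal complement of
`V ⊓ Eᗮ` in `V` is generated by a single vector with the Parseval property: the vector `S† e`, where
`S` is the partial isometry in the polar decomposition of the projection from `V` to `E`. -/
theorem exists_parseval_generator {T : ι → H →L[ℂ] H} (hT : ∀ p, ∃ q, adjoint (T p) = T q)
    {V E : Submodule ℂ H} (hVc : IsClosed (V : Set H)) (hV : ∀ p, ∀ f ∈ V, T p f ∈ V)
    (hEc : IsClosed (E : Set H)) (hE : ∀ p, ∀ f ∈ E, T p f ∈ E) {e : H}
    (he : ∀ f ∈ E, HasSum (fun p => ‖inner ℂ (T p e) f‖ ^ 2) (‖f‖ ^ 2)) :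
    ∃ φ : H, orbitSpan T φ ≤ V ∧ V ⊓ (orbitSpan T φ)ᗮ = V ⊓ Eᗮ ∧
      ∀ f ∈ orbitSpan T φ, HasSum (fun p => ‖inner ℂ (T p φ) f‖ ^ 2) (‖f‖ ^ 2) := by
  have := hVc.completeSpace_coe
  have := hEc.completeSpace_coe
  have hred : ∀ {W : Submodule ℂ H}, (∀ p, ∀ f ∈ W, T p f ∈ W) →
      ∀ p, ∀ f ∈ W, adjoint (T p) f ∈ W := fun hW p f hf => by
    obtain ⟨q, hq⟩ := hT p
    rw [hq]; exact hW q f hf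
  have hTP : ∀ p, Commute (T p) V.starProjection := fun p =>
    commute_starProjection (hV p) (hred hV p)
  have hTQ : ∀ p, Commute (T p) E.starProjection := fun p =>
    commute_starProjection (hE p) (hred hE p)
  set A : H →L[ℂ] H := E.starProjection * V.starProjection with hA
  have hA' : adjoint A = V.starProjection * E.starProjection := by
    change star A = _
    rw [hA, star_mul, (isSelfAdjoint_starProjection V).star_eq,
      (isSelfAdjoint_starProjection E).star_eq]
  obtain ⟨S, hSB, hS0, hSn, hSr, hSc⟩ := exists_polarDecomposition A
  have hAc : ∀ p, Commute (T p) A := fun p => (hTQ p).mul_right (hTP p)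
  have hTS : ∀ p x, T p (S x) = S (T p x) := fun p x =>
    congrArg (fun C : H →L[ℂ] H => C x)
      (hSc (T p) (hAc p) (by rw [hA']; exact (hTP p).mul_right (hTQ p)))
  have hKinv : ∀ p, ∀ f ∈ A.ker, T p f ∈ A.ker := fun p f hf => by
    have : A (T p f) = T p (A f) := (congrArg (fun C : H →L[ℂ] H => C f) (hAc p)).symm
    change A (T p f) = 0
    rw [this, show A f = 0 from hf, map_zero]
  have hSE : ∀ x, S x ∈ E := fun x => by
    refine topologicalClosure_minimal _ ?_ hEc (hSr x)
    rintro _ ⟨z, rfl⟩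
    exact starProjection_apply_mem _ _
  set φ : H := adjoint S e with hφ
  -- As `S` intertwines, the frame coefficients of `f` with respect to `φ` are those of `S f`
  -- with respect to `e`.
  have hin : ∀ p f, inner ℂ (T p φ) f = inner ℂ (T p e) (S f) := fun p f => by
    obtain ⟨q, hq⟩ := hT p
    rw [← adjoint_inner_right, hφ, adjoint_inner_left, hq, ← hTS, ← hq, adjoint_inner_right]
  have hsum : ∀ f ∈ A.kerᗮ, HasSum (fun p => ‖inner ℂ (T p φ) f‖ ^ 2) (‖f‖ ^ 2) :=
    fun f hf => by
      simp only [hin]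
      rw [← hSn f hf]
      exact he _ (hSE f)
  have hφK : φ ∈ A.kerᗮ := fun y hy => by
    rw [hφ, adjoint_inner_right, hS0 y hy, inner_zero_left]
  have hle : orbitSpan T φ ≤ A.kerᗮ := orbitSpan_le (isClosed_orthogonal _)
    fun p => mem_orthogonal_of_adjoint hT hKinv p hφK
  -- By the Parseval identity, nothing in `(ker A)ᗮ` is orthogonal to the orbit of `φ`.
  have hKe : (orbitSpan T φ)ᗮ ⊓ A.kerᗮ = ⊥ := by
    rw [Submodule.eq_bot_iff]
    rintro f ⟨h1, h2⟩
    have h3 := hsum f h2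
    have h4 : (fun p => ‖inner ℂ (T p φ) f‖ ^ 2) = fun _ => (0 : ℝ) := by
      funext p
      rw [h1 _ (apply_mem_orbitSpan T φ p)]
      simp
    rw [h4] at h3
    simpa using h3.unique hasSum_zero
  have hO : (orbitSpan T φ)ᗮ = A.ker := by
    refine le_antisymm (fun f hf => ?_) ?_
    · obtain ⟨u, hu, v, hv, rfl⟩ := A.ker.exists_add_mem_mem_orthogonal f
      have hu' : u ∈ (orbitSpan T φ)ᗮ :=
        Submodule.orthogonal_le hle (Submodule.le_orthogonal_orthogonal _ hu)
      have hv' : v ∈ (orbitSpan T φ)ᗮ := by simpa using Submodule.sub_mem _ hf hu'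
      have : v = 0 := (Submodule.eq_bot_iff _).1 hKe v ⟨hv', hv⟩
      rw [this, add_zero]; exact hu
    · exact (Submodule.le_orthogonal_orthogonal _).trans (Submodule.orthogonal_le hle)
  have hVK : A.kerᗮ ≤ V := by
    have : Vᗮ ≤ A.ker := fun f hf => by
      change E.starProjection (V.starProjection f) = 0
      rw [(starProjection_apply_eq_zero_iff V).2 hf, map_zero]
    exact (Submodule.orthogonal_le this).trans_eq (Submodule.orthogonal_orthogonal V)
  refine ⟨φ, hle.trans hVK, ?_, fun f hf => hsum f (hle hf)⟩
  rw [hO]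
  ext f
  simp only [mem_inf]
  refine and_congr_right fun hf => ?_
  rw [← starProjection_apply_eq_zero_iff (K := E)]
  change E.starProjection (V.starProjection f) = 0 ↔ _
  rw [starProjection_eq_self_iff.2 hf]

/-- Let `E i` be invariant subspaces with Parseval generators that together span the whole space.
Then every closed invariant subspace `V` is an orthogonal sum of orbit spans with Parseval
generators. Peeling off one generator for each `E i`, what is left of `V` after `j` steps is
`V ⊓ ⨅ i < j, (E i)ᗮ`. -/
theorem exists_orthogonal_parseval_generators {T : ι → H →L[ℂ] H}
    (hT : ∀ p, ∃ q, adjoint (T p) = T q)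
    {E : ℕ → Submodule ℂ H} (hEc : ∀ i, IsClosed (E i : Set H))
    (hE : ∀ i p, ∀ f ∈ E i, T p f ∈ E i) {e : ℕ → H}
    (he : ∀ i, ∀ f ∈ E i, HasSum (fun p => ‖inner ℂ (T p (e i)) f‖ ^ 2) (‖f‖ ^ 2))
    (htot : ∀ f, (∀ i, f ∈ (E i)ᗮ) → f = 0)
    {V : Submodule ℂ H} (hVc : IsClosed (V : Set H)) (hV : ∀ p, ∀ f ∈ V, T p f ∈ V) :
    ∃ φ : ℕ → H, (∀ i j, i ≠ j → orbitSpan T (φ i) ⟂ orbitSpan T (φ j)) ∧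
      (⨆ i, orbitSpan T (φ i)).topologicalClosure = V ∧
      ∀ i, ∀ f ∈ orbitSpan T (φ i),
        HasSum (fun p => ‖inner ℂ (T p (φ i)) f‖ ^ 2) (‖f‖ ^ 2) := by
  let W : ℕ → Submodule ℂ H := fun j => V ⊓ ⨅ i, ⨅ _ : i < j, (E i)ᗮ
  have hWmem : ∀ j f, f ∈ W j ↔ f ∈ V ∧ ∀ i < j, f ∈ (E i)ᗮ := fun j f => by
    simp [W, Submodule.mem_iInf]
  have hWc : ∀ j, IsClosed (W j : Set H) := fun j => by
    have : (W j : Set H) = (V : Set H) ∩ ⋂ i, ⋂ _ : i < j, ((E i)ᗮ : Set H) := by simp [W]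
    rw [this]
    exact hVc.inter (isClosed_iInter fun i => isClosed_iInter fun _ => isClosed_orthogonal _)
  have hW : ∀ j p, ∀ f ∈ W j, T p f ∈ W j := fun j p f hf => by
    rw [hWmem] at hf ⊢
    exact ⟨hV p f hf.1, fun i hi => mem_orthogonal_of_adjoint hT (hE i) p (hf.2 i hi)⟩
  choose φ h1 h2 h3 using fun j =>
    exists_parseval_generator hT (hWc j) (hW j) (hEc j) (hE j) (he j)
  have hlt : ∀ i j, i < j → orbitSpan T (φ i) ⟂ orbitSpan T (φ j) := by
    intro i j hij
    have : orbitSpan T (φ j) ≤ (orbitSpan T (φ i))ᗮ := by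
      intro f hf
      have hf' := (hWmem j f).1 (h1 j hf)
      have : f ∈ W i ⊓ (E i)ᗮ :=
        ⟨(hWmem i f).2 ⟨hf'.1, fun k hk => hf'.2 k (hk.trans hij)⟩, hf'.2 i hij⟩
      rw [← h2] at this
      exact this.2
    exact (Submodule.isOrtho_iff_le.2 this).symm
  refine ⟨φ, fun i j hij => hij.lt_or_gt.elim (hlt i j) fun h => (hlt j i h).symm, ?_, h3⟩
  have hle : (⨆ i, orbitSpan T (φ i)).topologicalClosure ≤ V :=
    topologicalClosure_minimal _ (iSup_le fun i => (h1 i).trans inf_le_left) hVc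
  refine le_antisymm hle fun f hf => ?_
  have hor : ∀ g ∈ V, g ∈ (⨆ i, orbitSpan T (φ i))ᗮ → g = 0 := by
    intro g hg hgo
    have hgi : ∀ i, g ∈ (orbitSpan T (φ i))ᗮ := fun i =>
      Submodule.orthogonal_le (le_iSup (fun i => orbitSpan T (φ i)) i) hgo
    have hgW : ∀ i, g ∈ W i := by
      intro i
      induction i with
      | zero => simpa [hWmem] using hg
      | succ k ih =>
        have : g ∈ W k ⊓ (orbitSpan T (φ k))ᗮ := ⟨ih, hgi k⟩
        rw [h2] at this
        rw [hWmem] at ih ⊢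
        refine ⟨hg, fun i hi => ?_⟩
        rcases Nat.lt_succ_iff_lt_or_eq.1 hi with h | rfl
        · exact ih.2 i h
        · exact this.2
    exact htot g fun i => ((hWmem _ _).1 (hgW (i + 1))).2 i i.lt_succ_self
  set Y := (⨆ i, orbitSpan T (φ i)).topologicalClosure with hY
  have : CompleteSpace Y := (isClosed_topologicalClosure _).completeSpace_coe
  have h0 := hor (f - Y.starProjection f) (V.sub_mem hf (hle (starProjection_apply_mem _ _)))
    (Submodule.orthogonal_le (le_topologicalClosure _) (sub_starProjection_mem_orthogonal f))
  rw [sub_eq_zero] at h0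
  rw [h0]
  exact starProjection_apply_mem _ _

end OrbitSpan

/-! ### Twisted translations as unitary operators -/

section TwistedTranslations

open Submodule ContinuousLinearMap

variable {n : ℕ}

theorem measurePreserving_sub_intVec (k l : Fin n → ℤ) :
    MeasurePreserving (fun z : PhaseSpace n => (z.1 - intVec k, z.2 - intVec l)) volume volume :=
  (measurePreserving_sub_right volume (intVec k)).prod
    (measurePreserving_sub_right volume (intVec l))

theorem twistedTranslateFun_congr_ae (k l : Fin n → ℤ) {f g : PhaseSpace n → ℂ}
    (h : f =ᵐ[volume] g) : twistedTranslateFun k l f =ᵐ[volume] twistedTranslateFun k l g := by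
  filter_upwards [(measurePreserving_sub_intVec k l).quasiMeasurePreserving.ae h] with z hz
  simp only [twistedTranslateFun, hz]

theorem coeFn_twistedTranslation (k l : Fin n → ℤ) (f : L2Phase n) :
    twistedTranslation k l f =ᵐ[volume] twistedTranslateFun k l f :=
  MemLp.coeFn_toLp _

theorem norm_twistedTranslation (k l : Fin n → ℤ) (f : L2Phase n) :
    ‖twistedTranslation k l f‖ = ‖f‖ := by
  rw [twistedTranslation, Lp.norm_toLp, Lp.norm_def]
  congr 1
  rw [← eLpNorm_comp_measurePreserving (Lp.aestronglyMeasurable f)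
    (measurePreserving_sub_intVec k l)]
  refine eLpNorm_congr_norm_ae (Filter.Eventually.of_forall fun z => ?_)
  simp only [twistedTranslateFun, Function.comp]
  rw [norm_mul, Complex.norm_exp_ofReal_mul_I, one_mul]

/-- The twisted translations as linear isometries. -/
noncomputable def twistedTranslationₗᵢ (p : (Fin n → ℤ) × (Fin n → ℤ)) :
    L2Phase n →ₗᵢ[ℂ] L2Phase n where
  toFun := twistedTranslation p.1 p.2
  map_add' f g := by
    refine Lp.ext ?_
    filter_upwards [coeFn_twistedTranslation p.1 p.2 (f + g), coeFn_twistedTranslation p.1 p.2 f,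
      coeFn_twistedTranslation p.1 p.2 g, twistedTranslateFun_congr_ae p.1 p.2 (Lp.coeFn_add f g),
      Lp.coeFn_add (twistedTranslation p.1 p.2 f) (twistedTranslation p.1 p.2 g)]
      with z h1 h2 h3 h4 h5
    rw [h1, h4, h5, Pi.add_apply, h2, h3]
    simp only [twistedTranslateFun, Pi.add_apply, mul_add]
  map_smul' c f := by
    refine Lp.ext ?_
    filter_upwards [coeFn_twistedTranslation p.1 p.2 (c • f), coeFn_twistedTranslation p.1 p.2 f,
      twistedTranslateFun_congr_ae p.1 p.2 (Lp.coeFn_smul c f),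
      Lp.coeFn_smul c (twistedTranslation p.1 p.2 f)] with z h1 h2 h4 h5
    rw [h1, h4, RingHom.id_apply, h5, Pi.smul_apply, h2]
    simp only [twistedTranslateFun, Pi.smul_apply, smul_eq_mul]
    ring
  norm_map' f := norm_twistedTranslation p.1 p.2 f

/-- The twisted translations as continuous linear operators. -/
noncomputable def twistedTranslationL (p : (Fin n → ℤ) × (Fin n → ℤ)) :
    L2Phase n →L[ℂ] L2Phase n :=
  (twistedTranslationₗᵢ p).toContinuousLinearMap

theorem twistedTranslationL_apply (p : (Fin n → ℤ) × (Fin n → ℤ)) (f : L2Phase n) :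
    twistedTranslationL p f = twistedTranslation p.1 p.2 f := rfl

/-- The twisted translations form a projective representation of `ℤ²ⁿ`. -/
theorem twistedTranslateFun_twistedTranslateFun (k l k' l' : Fin n → ℤ) (f : PhaseSpace n → ℂ) :
    twistedTranslateFun k l (twistedTranslateFun k' l' f) = fun z =>
      Complex.exp (((Real.pi * (intVec l ⬝ᵥ intVec k' - intVec k ⬝ᵥ intVec l') : ℝ) : ℂ) *
        Complex.I) * twistedTranslateFun (k + k') (l + l') f z := by
  have hadd : ∀ a b : Fin n → ℤ, intVec (a + b) = intVec a + intVec b := fun a b => by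
    ext j; simp [intVec]
  funext z
  simp only [twistedTranslateFun, hadd, sub_add_eq_sub_sub, dotProduct_add, sub_dotProduct]
  rw [← mul_assoc, ← mul_assoc, ← Complex.exp_add, ← Complex.exp_add, ← add_mul, ← add_mul]
  congr 3
  push_cast
  ring

theorem twistedTranslation_twistedTranslation (k l k' l' : Fin n → ℤ) (f : L2Phase n) :
    twistedTranslation k l (twistedTranslation k' l' f) =
      Complex.exp (((Real.pi * (intVec l ⬝ᵥ intVec k' - intVec k ⬝ᵥ intVec l') : ℝ) : ℂ) *
        Complex.I) • twistedTranslation (k + k') (l + l') f := by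
  refine Lp.ext ?_
  filter_upwards [coeFn_twistedTranslation k l (twistedTranslation k' l' f),
    twistedTranslateFun_congr_ae k l (coeFn_twistedTranslation k' l' f),
    coeFn_twistedTranslation (k + k') (l + l') f,
    Lp.coeFn_smul (Complex.exp (((Real.pi *
      (intVec l ⬝ᵥ intVec k' - intVec k ⬝ᵥ intVec l') : ℝ) : ℂ) * Complex.I))
      (twistedTranslation (k + k') (l + l') f)] with z h1 h2 h3 h4
  rw [h1, h2, h4, Pi.smul_apply, h3, twistedTranslateFun_twistedTranslateFun, smul_eq_mul]

theorem twistedTranslation_zero (f : L2Phase n) : twistedTranslation 0 0 f = f := by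
  refine Lp.ext ((coeFn_twistedTranslation 0 0 f).trans (Filter.Eventually.of_forall fun z => ?_))
  have h0 : intVec (0 : Fin n → ℤ) = 0 := by ext j; simp [intVec]
  simp [twistedTranslateFun, h0]

/-- The phase of `twistedTranslation_twistedTranslation` is trivial for opposite translations,
because the symplectic form vanishes on them. -/
theorem twistedTranslation_neg_cancel (k l : Fin n → ℤ) (f : L2Phase n) :
    twistedTranslation k l (twistedTranslation (-k) (-l) f) = f := by
  have hneg : ∀ a : Fin n → ℤ, intVec (-a) = -intVec a := fun a => by
    ext j; simp [intVec]
  rw [twistedTranslation_twistedTranslation, add_neg_cancel, add_neg_cancel,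
    twistedTranslation_zero, hneg, hneg, dotProduct_neg, dotProduct_neg,
    dotProduct_comm (intVec l)]
  simp

theorem adjoint_twistedTranslationL (p : (Fin n → ℤ) × (Fin n → ℤ)) :
    adjoint (twistedTranslationL p) = twistedTranslationL (-p) := by
  refine ((eq_adjoint_iff _ _).2 fun f g => ?_).symm
  rw [← (twistedTranslationₗᵢ p).inner_map_map (twistedTranslationL (-p) f) g]
  congr 1
  exact twistedTranslation_neg_cancel p.1 p.2 f

theorem twistedTranslationL_mem_orbitSpan (p : (Fin n → ℤ) × (Fin n → ℤ)) (e : L2Phase n)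
    {f : L2Phase n} (hf : f ∈ orbitSpan twistedTranslationL e) :
    twistedTranslationL p f ∈ orbitSpan twistedTranslationL e := by
  have hle : orbitSpan twistedTranslationL e ≤
      (orbitSpan twistedTranslationL e).comap (twistedTranslationL p).toLinearMap := by
    refine orbitSpan_le
      ((isClosed_topologicalClosure _).preimage (twistedTranslationL p).continuous) fun q => ?_
    change twistedTranslation p.1 p.2 (twistedTranslation q.1 q.2 e) ∈
      orbitSpan twistedTranslationL e
    rw [twistedTranslation_twistedTranslation]
    exact Submodule.smul_mem _ _ (apply_mem_orbitSpan twistedTranslationL e (p + q))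
  exact hle hf

/-! ### A total sequence of Parseval generators supported on the unit cube -/

/-- The unit cube `[0, 1)²ⁿ`, a fundamental domain for the translations by `ℤ²ⁿ`. -/
def unitCube (n : ℕ) : Set (PhaseSpace n) :=
  {z | ∀ j, z.1 j ∈ Set.Ico (0 : ℝ) 1 ∧ z.2 j ∈ Set.Ico (0 : ℝ) 1}

theorem measurableSet_unitCube : MeasurableSet (unitCube n) := by
  have : unitCube n = ⋂ j, {z : PhaseSpace n | z.1 j ∈ Set.Ico (0 : ℝ) 1} ∩
      {z | z.2 j ∈ Set.Ico (0 : ℝ) 1} := by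
    ext z; simp [unitCube]
  rw [this]
  refine MeasurableSet.iInter fun j => ?_
  exact ((by fun_prop : Measurable fun z : PhaseSpace n => z.1 j) measurableSet_Ico).inter
    ((by fun_prop : Measurable fun z : PhaseSpace n => z.2 j) measurableSet_Ico)

theorem sub_intVec_mem_unitCube_iff (k l : Fin n → ℤ) (z : PhaseSpace n) :
    ((z.1 - intVec k, z.2 - intVec l) : PhaseSpace n) ∈ unitCube n ↔
      (k, l) = ((fun j => ⌊z.1 j⌋, fun j => ⌊z.2 j⌋) : (Fin n → ℤ) × (Fin n → ℤ)) := by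
  have h : ∀ (x : ℝ) (m : ℤ), x - m ∈ Set.Ico (0 : ℝ) 1 ↔ m = ⌊x⌋ := fun x m => by
    rw [eq_comm, Int.floor_eq_iff, Set.mem_Ico, sub_nonneg, sub_lt_iff_lt_add']
  simp only [unitCube, Set.mem_ofPred_eq, Pi.sub_apply, intVec, h, forall_and, Prod.mk.injEq,
    funext_iff]

/-- Restriction of an `L²` function to the unit cube. -/
noncomputable def cubeRestrict (f : L2Phase n) : L2Phase n :=
  ((Lp.memLp f).indicator measurableSet_unitCube).toLp ((unitCube n).indicator f)

theorem coeFn_cubeRestrict (f : L2Phase n) :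
    cubeRestrict f =ᵐ[volume] (unitCube n).indicator f :=
  MemLp.coeFn_toLp _

theorem inner_cubeRestrict_left (f g : L2Phase n) :
    inner ℂ (cubeRestrict f) g = inner ℂ f (cubeRestrict g) := by
  rw [L2.inner_def, L2.inner_def]
  refine integral_congr_ae ?_
  filter_upwards [coeFn_cubeRestrict f, coeFn_cubeRestrict g] with z h1 h2
  rw [h1, h2]
  by_cases hz : z ∈ unitCube n <;> simp [hz]

/-- Functions supported on the cube have orthogonal translates, since the translated cubes are
disjoint. -/
theorem orthonormal_twistedTranslationL {e : L2Phase n} (he : ‖e‖ = 1)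
    (hs : ∀ᵐ z : PhaseSpace n, z ∉ unitCube n → e z = 0) :
    Orthonormal ℂ fun p => twistedTranslationL p e := by
  refine ⟨fun p => (norm_twistedTranslation p.1 p.2 e).trans he, fun p q hpq => ?_⟩
  dsimp only
  rw [L2.inner_def]
  refine integral_eq_zero_of_ae ?_
  filter_upwards [coeFn_twistedTranslation p.1 p.2 e, coeFn_twistedTranslation q.1 q.2 e,
    (measurePreserving_sub_intVec p.1 p.2).quasiMeasurePreserving.ae hs,
    (measurePreserving_sub_intVec q.1 q.2).quasiMeasurePreserving.ae hs] with z h1 h2 h3 h4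
  rw [twistedTranslationL_apply, twistedTranslationL_apply, h1, h2]
  simp only [twistedTranslateFun]
  rw [sub_intVec_mem_unitCube_iff] at h3 h4
  by_cases h : (p.1, p.2) = ((fun j => ⌊z.1 j⌋, fun j => ⌊z.2 j⌋) : (Fin n → ℤ) × (Fin n → ℤ))
  · rw [h4 fun h' => hpq (h.trans h'.symm)]
    simp
  · rw [h3 h]
    simp

/-- An `L²` function is determined by the restrictions of its translates to the unit cube, since
the translated cubes cover the phase space. -/
theorem eq_zero_of_cubeRestrict_eq_zero {f : L2Phase n}
    (h : ∀ k l : Fin n → ℤ, cubeRestrict (twistedTranslation (-k) (-l) f) = 0) : f = 0 := by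
  have hae : ∀ p : (Fin n → ℤ) × (Fin n → ℤ), ∀ᵐ z : PhaseSpace n,
      ((z.1 - intVec p.1, z.2 - intVec p.2) : PhaseSpace n) ∈ unitCube n → f z = 0 := by
    rintro ⟨k, l⟩
    have h0 : ∀ᵐ z : PhaseSpace n,
        z ∈ unitCube n → twistedTranslation (-k) (-l) f z = 0 := by
      have h1 := coeFn_cubeRestrict (twistedTranslation (-k) (-l) f)
      rw [h k l] at h1
      filter_upwards [h1, Lp.coeFn_zero ℂ 2 (volume : Measure (PhaseSpace n))] with z h2 h3 hz
      rw [h3, Set.indicator_of_mem hz] at h2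
      exact h2.symm
    have h1 := coeFn_twistedTranslation k l (twistedTranslation (-k) (-l) f)
    rw [twistedTranslation_neg_cancel] at h1
    filter_upwards [h1, (measurePreserving_sub_intVec k l).quasiMeasurePreserving.ae h0]
      with z h2 h3 hz
    rw [h2, twistedTranslateFun, h3 hz, mul_zero]
  rw [← ae_all_iff] at hae
  refine Lp.ext ?_
  filter_upwards [hae, Lp.coeFn_zero ℂ 2 (volume : Measure (PhaseSpace n))] with z hz h0
  rw [h0, hz (_, _) ((sub_intVec_mem_unitCube_iff _ _ z).2 rfl)]
  rfl

/-- There are vectors `e i`, each a Parseval generator of its orbit span, whose translates together span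
`L²(ℝ²ⁿ)`: take the normalized restrictions to the cube of a dense sequence. -/
theorem exists_total_parseval_sequence (n : ℕ) : ∃ e : ℕ → L2Phase n,
    (∀ i, ∀ f ∈ orbitSpan twistedTranslationL (e i),
      HasSum (fun p => ‖inner ℂ (twistedTranslationL p (e i)) f‖ ^ 2) (‖f‖ ^ 2)) ∧
    ∀ f, (∀ i, f ∈ (orbitSpan twistedTranslationL (e i))ᗮ) → f = 0 := by
  have : Fact ((2 : ℝ≥0∞) ≠ ∞) := ⟨by norm_num⟩
  let g := TopologicalSpace.denseSeq (L2Phase n)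
  -- If the restriction of `g i` vanishes, the scalar is `0⁻¹ = 0`; that generator is `0`.
  let c : ℕ → ℂ := fun i => ((‖cubeRestrict (g i)‖⁻¹ : ℝ) : ℂ)
  refine ⟨fun i => c i • cubeRestrict (g i), fun i f hf => ?_, fun f hf => ?_⟩
  · dsimp only at hf ⊢
    by_cases h0 : cubeRestrict (g i) = 0
    · rw [h0, smul_zero] at hf ⊢
      have : f ∈ (⊥ : Submodule ℂ (L2Phase n)) :=
        orbitSpan_le (by simp) (fun p => by simp) hf
      rw [(Submodule.mem_bot ℂ).1 this]
      simp
    · refine hasSum_of_orthonormal_orbit (orthonormal_twistedTranslationL ?_ ?_) hf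
      · rw [norm_smul, Complex.norm_real, norm_inv, norm_norm,
          inv_mul_cancel₀ (norm_ne_zero_iff.2 h0)]
      · filter_upwards [Lp.coeFn_smul (c i) (cubeRestrict (g i)), coeFn_cubeRestrict (g i)]
          with z h1 h2 hz
        rw [h1, Pi.smul_apply, h2, Set.indicator_of_notMem hz, smul_zero]
  · refine eq_zero_of_cubeRestrict_eq_zero fun k l => ?_
    refine (TopologicalSpace.denseRange_denseSeq (L2Phase n)).eq_zero_of_inner_right ℂ fun i => ?_
    have h1 : inner ℂ (twistedTranslationL (k, l) (c i • cubeRestrict (g i))) f = 0 :=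
      hf i _ (apply_mem_orbitSpan _ _ _)
    rw [← adjoint_inner_right, adjoint_twistedTranslationL, inner_smul_left,
      inner_cubeRestrict_left, mul_eq_zero] at h1
    rcases h1 with h1 | h1
    · have h2 : cubeRestrict (g i) = 0 := by simpa [c] using h1
      change inner ℂ (g i) _ = 0
      rw [← inner_cubeRestrict_left, h2, inner_zero_left]
    · exact h1

end TwistedTranslations

theorem mainTheorem2 (n : ℕ) (V : Submodule ℂ (L2Phase n)) (hV : IsTwistedShiftInvariant V) :
    ∃ φ : ℕ → L2Phase n,
      IsOrthogonalDirectSum V (fun i => principalSpace (φ i)) ∧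
      ∀ i, IsParsevalFrameGenerator (φ i) (principalSpace (φ i)) := by
  obtain ⟨e, he, htot⟩ := exists_total_parseval_sequence n
  obtain ⟨φ, h1, h2, h3⟩ := exists_orthogonal_parseval_generators
    (fun p => ⟨-p, adjoint_twistedTranslationL p⟩)
    (fun i => Submodule.isClosed_topologicalClosure _)
    (fun i p f hf => twistedTranslationL_mem_orbitSpan p (e i) hf) he htot hV.isClosed
    (fun p f hf => hV.translate_mem f hf p.1 p.2)
  exact ⟨φ, ⟨h1, h2⟩, h3⟩
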